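/- **Theorem (Classification of closed planar elasticae).** For $m\in[0,1)$ and $x\in\mathbf{R}$ let $F(x,m)=\int_0^x\frac{d\theta}{\sqrt{1-m\sin^2\theta}}$, $E(x,m)=\int_0^x\sqrt{1-m\sin^2\theta}\,d\theta$, $K(m)=F(\pi/2,m)$, $E(m)=E(\pi/2,m)$, let $\mathrm{am}(\cdot,m):\mathbf{R}\to\mathbf{R}$ be the inverse function of $F(\cdot,m)$, and let $\mathrm{cn}(s,m)=\cos(\mathrm{am}(s,m))$. A smooth ($C^\infty$) curve $\gamma:\mathbf{R}/\mathbf{Z}\to\mathbf{R}^2$ with nowhere vanishing derivative is called an elastica if for some $\lambda\in\mathbf{R}$ $$2\gamma_{ssss}+6\langle\gamma_{ss},\gamma_{sss}\rangle\gamma_s+3|\gamma_{ss}|^2\gamma_{ss}-\lambda\gamma_{ss}=0,$$ where $\partial_s\psi=\psi'/|\gamma'|$ is the arclength derivative along $\gamma$. There is a unique $m^*\in(0,1)$ with $2E(m^*)=K(m^*)$, and every elastica $\gamma:\mathbf{R}/\mathbf{Z}\to\mathbf{R}^2$ is either a round circle or a figure-eight elastica, possibly multiply covered. That is, there are a positive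 integer $\mu$, a similarity $\Phi$ of $\mathbf{R}^2$ (a composition of translation, rotation, reflection and dilation) and a smooth function $\varphi:\mathbf{R}\to\mathbf{R}$ with $\varphi'>0$ such that one of the following holds: 1. (circle covered $\mu$ times) $\varphi(x+1)=\varphi(x)+2\pi\mu$ and $\gamma(x)=\Phi\big(\sin\varphi(x),-\cos\varphi(x)\big)$ for all $x\in\mathbf{R}$; 2. (figure-eight elastica covered $\mu$ times) $\varphi(x+1)=\varphi(x)+4K(m^*)\mu$ and $\gamma(x)=\Phi\big(\gamma_w(\varphi(x))\big)$ for all $x\in\mathbf{R}$, where $\gamma_w(s)=\big(2E(\mathrm{am}(s,m^*),m^*)-s,\,-2\sqrt{m^*}\,\mathrm{cn}(s,m^*)\big)$. -/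

import Mathlib

open scoped ContDiff

noncomputable section

namespace Elastica

/-! ### Jacobi elliptic integrals and functions with parameter `m` (the square of the modulus) -/

/-- Incomplete elliptic integral of the first kind `F(x, m)`. -/
def ellipticF (x m : ℝ) : ℝ :=
  ∫ θ in (0 : ℝ)..x, 1 / Real.sqrt (1 - m * Real.sin θ ^ 2)

/-- Incomplete elliptic integral of the second kind `E(x, m)`. -/
def ellipticE (x m : ℝ) : ℝ :=
  ∫ θ in (0 : ℝ)..x, Real.sqrt (1 - m * Real.sin θ ^ 2)

/-- Complete elliptic integral of the first kind `K(m) = F(π/2, m)`. -/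
def completeK (m : ℝ) : ℝ := ellipticF (Real.pi / 2) m

/-- Complete elliptic integral of the second kind `E(m) = E(π/2, m)`. -/
def completeE (m : ℝ) : ℝ := ellipticE (Real.pi / 2) m

/-- Jacobi amplitude `am(·, m)`: the inverse function of `F(·, m)`, which is a bijection of `ℝ`
for `0 ≤ m < 1`; it is used only for such `m`. -/
def am (s m : ℝ) : ℝ := Function.invFun (fun x : ℝ => ellipticF x m) s

/-- Jacobi elliptic cosine `cn(s, m) = cos (am (s, m))`. -/
def cn (s m : ℝ) : ℝ := Real.cos (am s m)

/-! ### Elasticae -/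

/-- The arclength derivative `∂ₛψ = ψ' / |γ'|` of a map `ψ` along a curve `γ`. -/
def arcDeriv {n : ℕ} (γ ψ : ℝ → EuclideanSpace ℝ (Fin n)) : ℝ → EuclideanSpace ℝ (Fin n) :=
  fun x => ‖deriv γ x‖⁻¹ • deriv ψ x

/-- A smooth immersed curve `γ : ℝ → ℝⁿ` is a `lam`-elastica if it solves
`2 γ_ssss + 6 ⟨γ_ss, γ_sss⟩ γ_s + 3 |γ_ss|² γ_ss - lam γ_ss = 0`,
the subscript `s` denoting arclength derivatives along `γ`. -/
structure IsElasticaWith {n : ℕ} (lam : ℝ) (γ : ℝ → EuclideanSpace ℝ (Fin n)) : Prop where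
  smooth : ContDiff ℝ ∞ γ
  immersed : ∀ x, deriv γ x ≠ 0
  equation : ∀ x,
    (2 : ℝ) • ((arcDeriv γ)^[4] γ) x
      + (6 * inner ℝ (((arcDeriv γ)^[2] γ) x) (((arcDeriv γ)^[3] γ) x)) • arcDeriv γ γ x
      + (3 * ‖((arcDeriv γ)^[2] γ) x‖ ^ 2) • ((arcDeriv γ)^[2] γ) x
      - lam • ((arcDeriv γ)^[2] γ) x = 0

/-- A closed curve `γ : ℝ/ℤ → ℝⁿ` is a closed elastica if it is a `lam`-elastica for some real
`lam`.  Smoothness and derivatives on `ℝ/ℤ` are those of the `1`-periodic lift of `γ` to `ℝ`. -/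
def IsClosedElastica {n : ℕ} (γ : UnitAddCircle → EuclideanSpace ℝ (Fin n)) : Prop :=
  ∃ lam : ℝ, IsElasticaWith lam (fun x : ℝ => γ (x : UnitAddCircle))

/-! ### The model curves, and multiple covers up to similarity and reparametrization -/

/-- The circular elastica `γ_c(s) = (sin s, -cos s)`, of period `2π`. -/
def circular (s : ℝ) : EuclideanSpace ℝ (Fin 2) := !₂[Real.sin s, -Real.cos s]

/-- The wavelike elastica `γ_w(s, m) = (2 E(am(s, m), m) - s, -2 √m cn(s, m))`. -/
def wavelike (m s : ℝ) : EuclideanSpace ℝ (Fin 2) :=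
  !₂[2 * ellipticE (am s m) m - s, -2 * Real.sqrt m * cn s m]

/-- Let `c : ℝ → ℝ²` be a curve of period `P`.  The closed curve `γ : ℝ/ℤ → ℝ²` is, up to
similarity and reparametrization, the closed curve `c` on `ℝ/Pℤ` covered `μ` times:
`γ(x) = b + r A c(φ(x))` for a vector `b`, a ratio `r > 0`, a linear isometry `A` (a rotation or
a reflection) and a smooth `φ : ℝ → ℝ` with `φ' > 0` that advances by exactly `μ` periods when `x`
runs through `ℝ/ℤ` once.  The initial shift `s₀` of `c` is part of `φ`. -/
def IsCoverOf (μ : ℕ) (c : ℝ → EuclideanSpace ℝ (Fin 2)) (P : ℝ)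
    (γ : UnitAddCircle → EuclideanSpace ℝ (Fin 2)) : Prop :=
  ∃ (b : EuclideanSpace ℝ (Fin 2)) (r : ℝ)
    (A : EuclideanSpace ℝ (Fin 2) ≃ₗᵢ[ℝ] EuclideanSpace ℝ (Fin 2)) (φ : ℝ → ℝ),
    0 < r ∧ ContDiff ℝ ∞ φ ∧ (∀ x, 0 < deriv φ x) ∧ (∀ x, φ (x + 1) = φ x + μ * P) ∧
    ∀ x : ℝ, γ (x : UnitAddCircle) = b + r • A (c (φ x))

/-- A round circle covered `μ` times. -/
def IsCircle (μ : ℕ) (γ : UnitAddCircle → EuclideanSpace ℝ (Fin 2)) : Prop :=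
  IsCoverOf μ circular (2 * Real.pi) γ

/-- The parameter of the figure-eight elastica: `m ∈ (0, 1)` with `2 E(m) = K(m)`. -/
def IsFigureEightParameter (m : ℝ) : Prop :=
  0 < m ∧ m < 1 ∧ 2 * completeE m = completeK m

/-- The figure-eight elastica covered `μ` times: the wavelike elastica with `2 E(m) = K(m)`, which
has period `4 K(m)`. -/
def IsFigureEight (μ : ℕ) (m : ℝ) (γ : UnitAddCircle → EuclideanSpace ℝ (Fin 2)) : Prop :=
  IsFigureEightParameter m ∧ IsCoverOf μ (wavelike m) (4 * completeK m) γ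

end Elastica

end

/-! The elastica equation says that the force vector `V = 2γ_sss + 3|γ_ss|²γ_s - λγ_s` is constant
along the curve. With unit tangent `T`, normal `N` and curvature `k` it reads `V = (k² - λ)T + 2k_s
N` (`IsElasticaWith.exists_isElasticFrame`).

If `V = 0`, then `k` is constant. It is not zero, since a line does not close, so the curve is a
circle.

If `V ≠ 0`, the normal component says that the angle from `V` to `T` moves like a pendulum. Put `X`
for the coordinate along `V`. Closedness forces `k` to vanish somewhere: otherwise, in rescaled
arclength, with `s` the sine of the angle and `κ` its velocity, `s/κ - X` would be periodic with
derivative `(s/κ)² ≥ 0` (`exists_vel_eq_zero`). Where `k = 0` the pendulum is at a turning point and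
not at an equilibrium. There its data agree with those of a wavelike elastica at the quarter period
`K(m)`, for one `m ∈ (0,1)`, so uniqueness for the pendulum (`eq_of_eq_at`) identifies the two
curves. A wavelike arc closes only after `n` full periods with `8nE(m) = 4nK(m)`
(`wavelike_closed`).

The parameter `m*` exists and is unique because `2E - K` is continuous, strictly decreasing,
positive at `0` and negative near `1`. -/

namespace Elastica

/-! ### Elliptic integrals -/

theorem one_sub_mul_sin_sq_pos {m : ℝ} (hm1 : m < 1) (x : ℝ) :
    0 < 1 - m * Real.sin x ^ 2 := by
  have h1 := Real.sin_sq_le_one x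
  have h2 := sq_nonneg (Real.sin x)
  rcases le_or_gt m 0 with h | h <;> nlinarith

theorem continuous_sqrt_one_sub (m : ℝ) :
    Continuous fun x : ℝ => Real.sqrt (1 - m * Real.sin x ^ 2) := by fun_prop

theorem continuous_one_div_sqrt_one_sub {m : ℝ} (hm1 : m < 1) :
    Continuous fun x : ℝ => 1 / Real.sqrt (1 - m * Real.sin x ^ 2) :=
  continuous_const.div (continuous_sqrt_one_sub m)
    fun x => (Real.sqrt_pos.2 (one_sub_mul_sin_sq_pos hm1 x)).ne'

theorem hasDerivAt_ellipticE (m x : ℝ) :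
    HasDerivAt (fun x => ellipticE x m) (Real.sqrt (1 - m * Real.sin x ^ 2)) x :=
  intervalIntegral.integral_hasDerivAt_right
    ((continuous_sqrt_one_sub m).intervalIntegrable _ _)
    ((continuous_sqrt_one_sub m).stronglyMeasurableAtFilter _ _)
    (continuous_sqrt_one_sub m).continuousAt

theorem hasDerivAt_ellipticF {m : ℝ} (hm1 : m < 1) (x : ℝ) :
    HasDerivAt (fun x => ellipticF x m) (1 / Real.sqrt (1 - m * Real.sin x ^ 2)) x :=
  intervalIntegral.integral_hasDerivAt_right
    ((continuous_one_div_sqrt_one_sub hm1).intervalIntegrable _ _)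
    ((continuous_one_div_sqrt_one_sub hm1).stronglyMeasurableAtFilter _ _)
    (continuous_one_div_sqrt_one_sub hm1).continuousAt

theorem ellipticE_zero (m : ℝ) : ellipticE 0 m = 0 := by simp [ellipticE]

theorem ellipticF_zero (m : ℝ) : ellipticF 0 m = 0 := by simp [ellipticF]

/-- The integral of a function of `sin²` over `n` periods of the sine. -/
theorem integral_comp_sin_sq {g : ℝ → ℝ} (hg : Continuous fun x => g (Real.sin x ^ 2)) (n : ℤ) :
    ∫ x in (0 : ℝ)..n * (2 * Real.pi), g (Real.sin x ^ 2)
      = n * (4 * ∫ x in (0 : ℝ)..Real.pi / 2, g (Real.sin x ^ 2)) := by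
  have hi : ∀ a b : ℝ, IntervalIntegrable (fun x => g (Real.sin x ^ 2)) MeasureTheory.volume a b :=
    fun a b => hg.intervalIntegrable a b
  have hper : Function.Periodic (fun x => g (Real.sin x ^ 2)) Real.pi := by
    intro x; simp [Real.sin_add_pi]
  have hhalf : ∫ x in (Real.pi / 2)..Real.pi, g (Real.sin x ^ 2)
      = ∫ x in (0 : ℝ)..Real.pi / 2, g (Real.sin x ^ 2) := by
    have h := intervalIntegral.integral_comp_sub_left (a := 0) (b := Real.pi / 2)
      (fun x => g (Real.sin x ^ 2)) Real.pi
    simp only [Real.sin_pi_sub] at h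
    rw [h]
    congr 1 <;> ring
  have hpi : ∫ x in (0 : ℝ)..Real.pi, g (Real.sin x ^ 2)
      = 2 * ∫ x in (0 : ℝ)..Real.pi / 2, g (Real.sin x ^ 2) := by
    rw [← intervalIntegral.integral_add_adjacent_intervals (hi 0 (Real.pi / 2)) (hi _ _), hhalf]
    ring
  have h := hper.intervalIntegral_add_zsmul_eq (2 * n) 0 hi
  simp only [zero_add, zsmul_eq_mul] at h
  rw [hpi] at h
  push_cast at h
  rw [show (n : ℝ) * (2 * Real.pi) = 2 * n * Real.pi by ring, h]
  ring

theorem ellipticF_int_mul_two_pi {m : ℝ} (hm1 : m < 1) (n : ℤ) :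
    ellipticF (n * (2 * Real.pi)) m = n * (4 * completeK m) :=
  integral_comp_sin_sq (g := fun u => 1 / Real.sqrt (1 - m * u))
    (continuous_one_div_sqrt_one_sub hm1) n

theorem ellipticE_int_mul_two_pi (m : ℝ) (n : ℤ) :
    ellipticE (n * (2 * Real.pi)) m = n * (4 * completeE m) :=
  integral_comp_sin_sq (g := fun u => Real.sqrt (1 - m * u)) (continuous_sqrt_one_sub m) n

theorem completeK_pos {m : ℝ} (hm1 : m < 1) : 0 < completeK m :=
  intervalIntegral.intervalIntegral_pos_of_pos
    ((continuous_one_div_sqrt_one_sub hm1).intervalIntegrable _ _)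
    (fun x => one_div_pos.2 (Real.sqrt_pos.2 (one_sub_mul_sin_sq_pos hm1 x)))
    (by positivity)

/-! ### The amplitude -/

theorem strictMono_ellipticF {m : ℝ} (hm1 : m < 1) : StrictMono fun x => ellipticF x m :=
  strictMono_of_hasDerivAt_pos (hasDerivAt_ellipticF hm1)
    fun x => one_div_pos.2 (Real.sqrt_pos.2 (one_sub_mul_sin_sq_pos hm1 x))

theorem continuous_ellipticF {m : ℝ} (hm1 : m < 1) : Continuous fun x => ellipticF x m :=
  continuous_iff_continuousAt.2 fun x => (hasDerivAt_ellipticF hm1 x).continuousAt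

theorem surjective_of_arithmetic_progression {f : ℝ → ℝ} (hf : Continuous f) {u : ℤ → ℝ} {b P : ℝ}
    (hP : 0 < P) (h : ∀ n, f (u n) = b + n * P) : Function.Surjective f := by
  intro y
  obtain ⟨n, hn⟩ := exists_int_gt ((y - b) / P)
  obtain ⟨k, hk⟩ := exists_int_lt ((y - b) / P)
  rw [div_lt_iff₀ hP] at hn
  rw [lt_div_iff₀ hP] at hk
  exact mem_range_of_exists_le_of_exists_ge hf
    ⟨u k, by rw [h]; linarith⟩ ⟨u n, by rw [h]; linarith⟩

theorem surjective_ellipticF {m : ℝ} (hm1 : m < 1) :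
    Function.Surjective fun x => ellipticF x m :=
  surjective_of_arithmetic_progression (continuous_ellipticF hm1)
    (b := 0) (mul_pos four_pos (completeK_pos hm1))
    fun n => (ellipticF_int_mul_two_pi hm1 n).trans (zero_add _).symm

theorem ellipticF_am {m : ℝ} (hm1 : m < 1) (s : ℝ) : ellipticF (am s m) m = s :=
  Function.rightInverse_invFun (surjective_ellipticF hm1) s

theorem am_ellipticF {m : ℝ} (hm1 : m < 1) (x : ℝ) : am (ellipticF x m) m = x :=
  Function.leftInverse_invFun (strictMono_ellipticF hm1).injective x

theorem am_completeK {m : ℝ} (hm1 : m < 1) : am (completeK m) m = Real.pi / 2 :=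
  am_ellipticF hm1 _

theorem am_zero {m : ℝ} (hm1 : m < 1) : am 0 m = 0 := by
  simpa [ellipticF_zero] using am_ellipticF hm1 0

theorem continuous_am {m : ℝ} (hm1 : m < 1) : Continuous fun s => am s m := by
  refine Monotone.continuous_of_surjective (fun s t hst => ?_) fun x => ⟨_, am_ellipticF hm1 x⟩
  refine (strictMono_ellipticF hm1).le_iff_le.1 ?_
  simpa only [ellipticF_am hm1] using hst

theorem hasDerivAt_am {m : ℝ} (hm1 : m < 1) (s : ℝ) :
    HasDerivAt (fun s => am s m) (Real.sqrt (1 - m * Real.sin (am s m) ^ 2)) s := by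
  have h := HasDerivAt.of_local_left_inverse (continuous_am hm1).continuousAt
    (hasDerivAt_ellipticF hm1 (am s m))
    (one_div_pos.2 (Real.sqrt_pos.2 (one_sub_mul_sin_sq_pos hm1 _))).ne'
    (Filter.Eventually.of_forall (ellipticF_am hm1))
  simpa using h

/-! ### The figure-eight parameter -/

theorem two_completeE_sub_completeK {m : ℝ} (hm1 : m < 1) :
    2 * completeE m - completeK m = ∫ x in (0 : ℝ)..Real.pi / 2,
      (2 * Real.sqrt (1 - m * Real.sin x ^ 2) - 1 / Real.sqrt (1 - m * Real.sin x ^ 2)) := by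
  rw [intervalIntegral.integral_sub
    (((continuous_sqrt_one_sub m).const_mul 2).intervalIntegrable _ _)
    ((continuous_one_div_sqrt_one_sub hm1).intervalIntegrable _ _),
    intervalIntegral.integral_const_mul]
  rfl

/-- The integrand decreases in `m` at every angle, and strictly at `π/2`, where the sine is `1`. -/
theorem two_completeE_sub_completeK_strictAntiOn :
    StrictAntiOn (fun m => 2 * completeE m - completeK m) (Set.Iio 1) := by
  intro m hm n hn hmn
  simp only [two_completeE_sub_completeK hm, two_completeE_sub_completeK hn]
  have hc : ∀ m < (1 : ℝ), Continuous fun x =>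
      2 * Real.sqrt (1 - m * Real.sin x ^ 2) - 1 / Real.sqrt (1 - m * Real.sin x ^ 2) :=
    fun m hm => ((continuous_sqrt_one_sub m).const_mul 2).sub (continuous_one_div_sqrt_one_sub hm)
  refine intervalIntegral.integral_lt_integral_of_continuousOn_of_le_of_exists_lt (by positivity)
    (hc n hn).continuousOn (hc m hm).continuousOn (fun x _ => ?_)
    ⟨Real.pi / 2, ⟨by positivity, le_rfl⟩, ?_⟩
  · have h1 : Real.sqrt (1 - n * Real.sin x ^ 2) ≤ Real.sqrt (1 - m * Real.sin x ^ 2) :=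
      Real.sqrt_le_sqrt (by nlinarith [sq_nonneg (Real.sin x)])
    have h2 := one_div_le_one_div_of_le (Real.sqrt_pos.2 (one_sub_mul_sin_sq_pos hn x)) h1
    linarith
  · have h1 : Real.sqrt (1 - n * Real.sin (Real.pi / 2) ^ 2)
        < Real.sqrt (1 - m * Real.sin (Real.pi / 2) ^ 2) :=
      Real.sqrt_lt_sqrt (one_sub_mul_sin_sq_pos hn _).le (by rw [Real.sin_pi_div_two]; linarith)
    have h2 := one_div_le_one_div_of_le (Real.sqrt_pos.2 (one_sub_mul_sin_sq_pos hn _)) h1.le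
    linarith

theorem continuousOn_two_completeE_sub_completeK {b : ℝ} (hb : b < 1) :
    ContinuousOn (fun m => 2 * completeE m - completeK m) (Set.Iic b) := by
  have hmin : ∀ m, min m b < 1 := fun m => (min_le_right _ _).trans_lt hb
  -- Truncating `m` at `b` keeps the radicand positive for all real `m`, so the integrand is jointly
  -- continuous on the whole plane.
  have hc : Continuous fun m : ℝ => ∫ x in (0 : ℝ)..Real.pi / 2,
      (2 * Real.sqrt (1 - min m b * Real.sin x ^ 2)
        - 1 / Real.sqrt (1 - min m b * Real.sin x ^ 2)) := by
    refine intervalIntegral.continuous_parametric_intervalIntegral_of_continuous' ?_ _ _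
    refine Continuous.sub (by fun_prop) (continuous_const.div (by fun_prop) fun p => ?_)
    exact (Real.sqrt_pos.2 (one_sub_mul_sin_sq_pos (hmin p.1) p.2)).ne'
  refine hc.continuousOn.congr fun m hm => ?_
  simp only [min_eq_left (Set.mem_Iic.1 hm)]
  exact two_completeE_sub_completeK (lt_of_le_of_lt hm hb)

/-- For `m = 1 - e²` the radicand is `cos² + e² sin² ≤ (cos + e)²`. -/
theorem completeE_le {e : ℝ} (he : 0 ≤ e) :
    completeE (1 - e ^ 2) ≤ 1 + e * (Real.pi / 2) := by
  have h : completeE (1 - e ^ 2) ≤ ∫ x in (0 : ℝ)..Real.pi / 2, (Real.cos x + e) := by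
    refine intervalIntegral.integral_mono_on (by positivity)
      ((continuous_sqrt_one_sub _).intervalIntegrable _ _)
      ((by fun_prop : Continuous fun x => Real.cos x + e).intervalIntegrable _ _) fun x hx => ?_
    have hcos := Real.cos_nonneg_of_mem_Icc (x := x) ⟨by linarith [hx.1, Real.pi_pos], hx.2⟩
    refine Real.sqrt_le_iff.2 ⟨by positivity, ?_⟩
    have hs := Real.sin_sq_add_cos_sq x
    nlinarith [mul_nonneg hcos he, mul_nonneg (sq_nonneg e) (sq_nonneg (Real.cos x))]
  refine h.trans_eq ?_
  rw [intervalIntegral.integral_add (Real.continuous_cos.intervalIntegrable _ _)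
    (continuous_const.intervalIntegrable _ _)]
  simp
  ring

/-- The logarithmic divergence of `K` at `m = 1`: since `cos x ≤ π/2 - x`, the radicand `cos² + e²
sin²` is at most `(e + (π/2 - x))²`. -/
theorem log_le_completeK {e : ℝ} (he : 0 < e) :
    Real.log (1 + Real.pi / 2 / e) ≤ completeK (1 - e ^ 2) := by
  have hm1 : 1 - e ^ 2 < 1 := by linarith [pow_pos he 2]
  have hpos : ∀ x ∈ Set.uIcc 0 (Real.pi / 2), e + (Real.pi / 2 - x) ≠ 0 := by
    intro x hx
    rw [Set.uIcc_of_le (by positivity)] at hx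
    linarith [hx.2]
  have hcont : ContinuousOn (fun x => 1 / (e + (Real.pi / 2 - x))) (Set.uIcc 0 (Real.pi / 2)) :=
    continuousOn_const.div (by fun_prop) hpos
  have h : ∫ x in (0 : ℝ)..Real.pi / 2, 1 / (e + (Real.pi / 2 - x)) ≤ completeK (1 - e ^ 2) := by
    refine intervalIntegral.integral_mono_on (by positivity) hcont.intervalIntegrable
      ((continuous_one_div_sqrt_one_sub hm1).intervalIntegrable _ _) fun x hx => ?_
    refine one_div_le_one_div_of_le (Real.sqrt_pos.2 (one_sub_mul_sin_sq_pos hm1 x)) ?_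
    have hy : 0 ≤ Real.pi / 2 - x := by linarith [hx.2]
    refine Real.sqrt_le_iff.2 ⟨by positivity, ?_⟩
    have hcos := Real.cos_nonneg_of_mem_Icc (x := x) ⟨by linarith [hx.1, Real.pi_pos], hx.2⟩
    have hle : Real.cos x ≤ Real.pi / 2 - x := by
      rw [← Real.sin_pi_div_two_sub]; exact Real.sin_le hy
    have hs := Real.sin_sq_add_cos_sq x
    have h2 := pow_le_pow_left₀ hcos hle 2
    nlinarith [mul_nonneg hy he.le, mul_nonneg (sq_nonneg e) (sq_nonneg (Real.cos x))]
  refine le_trans (le_of_eq ?_) h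
  have hint := intervalIntegral.integral_eq_sub_of_hasDerivAt
    (f := fun x => -Real.log (e + (Real.pi / 2 - x)))
    (f' := fun x => 1 / (e + (Real.pi / 2 - x))) (a := 0) (b := Real.pi / 2)
    (fun x hx => by
      have h1 : HasDerivAt (fun x => e + (Real.pi / 2 - x)) (-1) x :=
        ((hasDerivAt_id x).const_sub _).const_add _
      exact (h1.log (hpos x hx)).neg.congr_deriv (by ring))
    hcont.intervalIntegrable
  rw [hint]
  have h0 : 1 + Real.pi / 2 / e = (e + Real.pi / 2) / e := by field_simp
  rw [h0, Real.log_div (by positivity) he.ne']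
  simp
  ring

theorem exists_figureEightParameter : ∃ m, IsFigureEightParameter m := by
  -- With `e = 1/20`, `K ≥ log (1 + 10π) ≥ log 32 = 5 log 2 > 3.4`, while `2E ≤ 2 + π/20 < 2.2`.
  obtain ⟨b, hb⟩ : ∃ b : ℝ, b = 1 - (1 / 20) ^ 2 := ⟨_, rfl⟩
  have hb1 : b < 1 := by norm_num [hb]
  have h0 : 0 < 2 * completeE 0 - completeK 0 := by
    simp [completeE, completeK, ellipticE, ellipticF]
    linarith [Real.pi_pos]
  have hbneg : 2 * completeE b - completeK b < 0 := by
    have hE := completeE_le (e := 1 / 20) (by norm_num)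
    have hK := log_le_completeK (e := 1 / 20) (by norm_num)
    have hlog : 5 * Real.log 2 ≤ Real.log (1 + Real.pi / 2 / (1 / 20)) := by
      rw [show (5 : ℝ) * Real.log 2 = Real.log (2 ^ 5) by rw [Real.log_pow]; norm_num]
      refine Real.log_le_log (by norm_num) ?_
      linarith [Real.pi_gt_d2]
    rw [← hb] at hE hK
    have hbK := hlog.trans hK
    have h2 := Real.log_two_gt_d9
    have h3 := Real.pi_lt_d2
    clear hlog hK
    linarith
  obtain ⟨m, hm, hm0⟩ := intermediate_value_Ioo' (by norm_num [hb] : (0 : ℝ) ≤ b)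
    ((continuousOn_two_completeE_sub_completeK hb1).mono Set.Icc_subset_Iic_self)
    (show (0 : ℝ) ∈ Set.Ioo _ _ from ⟨hbneg, h0⟩)
  exact ⟨m, hm.1, hm.2.trans hb1, sub_eq_zero.1 hm0⟩

theorem figureEightParameter_unique {m n : ℝ} (hm : IsFigureEightParameter m)
    (hn : IsFigureEightParameter n) : m = n :=
  two_completeE_sub_completeK_strictAntiOn.injOn hm.2.1 hn.2.1
    (by simp only [sub_eq_zero.2 hm.2.2, sub_eq_zero.2 hn.2.2])

/-! ### The pendulum system -/

/-- The motion `c + i s` of a unit vector with angular velocity `w κ`, where `κ' = -w s`.  It is the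
equation of the pendulum with respect to the time `∫ w`. -/
structure IsPendulum (w c s κ : ℝ → ℝ) : Prop where
  hasDerivAt_cos : ∀ x, HasDerivAt c (-(w x * κ x * s x)) x
  hasDerivAt_sin : ∀ x, HasDerivAt s (w x * κ x * c x) x
  hasDerivAt_vel : ∀ x, HasDerivAt κ (-(w x * s x)) x
  sq_add_sq : ∀ x, c x ^ 2 + s x ^ 2 = 1

theorem eq_of_hasDerivAt_zero {f : ℝ → ℝ} (h : ∀ x, HasDerivAt f 0 x) (x y : ℝ) : f x = f y :=
  is_const_of_deriv_eq_zero (fun x => (h x).differentiableAt) (fun x => (h x).deriv) x y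

/-- A nonnegative function whose logarithmic derivative is bounded by `a φ'` vanishes identically
as soon as it vanishes somewhere. -/
theorem eq_zero_of_abs_deriv_le {D D' φ w : ℝ → ℝ} {a x₀ : ℝ} (hD : ∀ x, HasDerivAt D (D' x) x)
    (hφ : ∀ x, HasDerivAt φ (w x) x) (hle : ∀ x, |D' x| ≤ a * w x * D x) (hnonneg : ∀ x, 0 ≤ D x)
    (h0 : D x₀ = 0) (x : ℝ) : D x = 0 := by
  have hexp : ∀ b x, HasDerivAt (fun x => D x * Real.exp (b * φ x))
      ((D' x + b * w x * D x) * Real.exp (b * φ x)) x := fun b x =>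
    ((hD x).mul (((hφ x).const_mul b).exp)).congr_deriv (by ring)
  -- Grönwall in both directions: this product controls `D` to the right of `x₀`, the next one to
  -- the left.
  have hanti : Antitone fun x => D x * Real.exp (-a * φ x) := by
    refine antitone_of_hasDerivAt_nonpos (hexp (-a)) fun x =>
      mul_nonpos_of_nonpos_of_nonneg ?_ (Real.exp_pos _).le
    linarith [(abs_le.1 (hle x)).2]
  have hmono : Monotone fun x => D x * Real.exp (a * φ x) := by
    refine monotone_of_hasDerivAt_nonneg (hexp a) fun x =>
      mul_nonneg ?_ (Real.exp_pos _).le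
    linarith [(abs_le.1 (hle x)).1]
  refine le_antisymm ?_ (hnonneg x)
  rcases le_total x₀ x with h | h
  · have := hanti h
    simp only [h0, zero_mul] at this
    exact nonpos_of_mul_nonpos_left this (Real.exp_pos _)
  · have := hmono h
    simp only [h0, zero_mul] at this
    exact nonpos_of_mul_nonpos_left this (Real.exp_pos _)

namespace IsPendulum

variable {w c s κ c' s' κ' φ : ℝ → ℝ}

/-- Grönwall for the squared distance of two solutions. In its derivative the terms multiplied by
`κ` cancel, because rotation preserves length. Only the bounds `|c'|, |s'| ≤ 1` are needed, and none
on the velocities. -/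
theorem eq_of_eq_at (h : IsPendulum w c s κ) (h' : IsPendulum w c' s' κ')
    (hφ : ∀ x, HasDerivAt φ (w x) x) (hw : ∀ x, 0 < w x) {x₀ : ℝ} (hc : c x₀ = c' x₀)
    (hs : s x₀ = s' x₀) (hκ : κ x₀ = κ' x₀) (x : ℝ) :
    c x = c' x ∧ s x = s' x ∧ κ x = κ' x := by
  have hD := eq_zero_of_abs_deriv_le (a := 3) (x₀ := x₀) (φ := φ) (w := w)
    (D := fun x => (c x - c' x) ^ 2 + (s x - s' x) ^ 2 + (κ x - κ' x) ^ 2)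
    (D' := fun x => 2 * w x * (κ x - κ' x) *
      (c' x * (s x - s' x) - s' x * (c x - c' x) - (s x - s' x)))
    (fun x => by
      refine (((((h.hasDerivAt_cos x).sub (h'.hasDerivAt_cos x)).pow 2).add
        (((h.hasDerivAt_sin x).sub (h'.hasDerivAt_sin x)).pow 2)).add
        (((h.hasDerivAt_vel x).sub (h'.hasDerivAt_vel x)).pow 2)).congr_deriv ?_
      simp only [Pi.sub_apply]
      push_cast
      ring) hφ
    (fun x => by
      have hu := h'.sq_add_sq x
      have hw := hw x
      set p := c x - c' x
      set q := s x - s' x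
      set r := κ x - κ' x
      set u := c' x
      set v := s' x
      have hu1 : |u| ≤ 1 := abs_le_one_iff_mul_self_le_one.2 (by nlinarith [sq_nonneg v])
      have hv1 : |v| ≤ 1 := abs_le_one_iff_mul_self_le_one.2 (by nlinarith [sq_nonneg u])
      have h1 : |u * q - v * p - q| ≤ 2 * |q| + |p| := by
        calc |u * q - v * p - q| ≤ |u| * |q| + |v| * |p| + |q| := by
              rw [← abs_mul, ← abs_mul]
              exact (abs_sub _ _).trans (add_le_add_left (abs_sub _ _) _)
          _ ≤ 1 * |q| + 1 * |p| + |q| := by gcongr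
          _ = 2 * |q| + |p| := by ring
      rw [abs_mul, abs_mul, abs_mul, abs_of_pos hw, abs_two]
      calc 2 * w x * |r| * |u * q - v * p - q| ≤ 2 * w x * |r| * (2 * |q| + |p|) := by gcongr
        _ = w x * (2 * |r| * (2 * |q| + |p|)) := by ring
        _ ≤ w x * (3 * (|p| ^ 2 + |q| ^ 2 + |r| ^ 2)) := by
            refine mul_le_mul_of_nonneg_left ?_ hw.le
            nlinarith [sq_nonneg (|r| - |q|), sq_nonneg (|r| - |p|), sq_nonneg |p|, sq_nonneg |q|]
        _ = 3 * w x * (p ^ 2 + q ^ 2 + r ^ 2) := by simp only [sq_abs]; ring)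
    (fun x => by positivity) (by simp [hc, hs, hκ]) x
  have h1 := sq_nonneg (c x - c' x)
  have h2 := sq_nonneg (s x - s' x)
  have h3 := sq_nonneg (κ x - κ' x)
  refine ⟨?_, ?_, ?_⟩ <;> refine sub_eq_zero.1 (pow_eq_zero_iff two_ne_zero |>.1 ?_) <;> linarith

/-- Reflection in the force axis; it serves to make `s` positive at the turning point. -/
theorem neg (h : IsPendulum w c s κ) :
    IsPendulum w c (fun x => -s x) (fun x => -κ x) where
  hasDerivAt_cos x := (h.hasDerivAt_cos x).congr_deriv (by ring)
  hasDerivAt_sin x := (h.hasDerivAt_sin x).fun_neg.congr_deriv (by ring)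
  hasDerivAt_vel x := (h.hasDerivAt_vel x).fun_neg.congr_deriv (by ring)
  sq_add_sq x := by rw [neg_sq, h.sq_add_sq]

end IsPendulum

theorem not_periodic_of_hasDerivAt_pos {f f' : ℝ → ℝ} (hf : ∀ x, HasDerivAt f (f' x) x)
    (hpos : ∀ x, 0 < f' x) : ¬ Function.Periodic f 1 := fun h =>
  absurd (h 0) (strictMono_of_hasDerivAt_pos hf hpos (by norm_num : (0 : ℝ) < 0 + 1)).ne'

theorem Monotone.eq_of_periodic {f : ℝ → ℝ} (hf : Monotone f) (hp : Function.Periodic f 1)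
    (x y : ℝ) : f x = f y := by
  have key : ∀ x y, x ≤ y → f x = f y := by
    intro x y hxy
    obtain ⟨n, hn⟩ := exists_nat_ge (y - x)
    refine le_antisymm (hf hxy) ?_
    have h := hf (show y ≤ x + n * 1 by linarith)
    rwa [hp.nat_mul n x] at h
  rcases le_total x y with h | h
  · exact key x y h
  · exact (key y x h).symm

namespace IsPendulum

variable {w c s κ X φ : ℝ → ℝ}

/-- If `∫ c` is periodic, then the velocity of a periodic pendulum vanishes somewhere. -/
theorem exists_vel_eq_zero (h : IsPendulum w c s κ) (hw : ∀ x, 0 < w x)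
    (hX : ∀ x, HasDerivAt X (w x * c x) x) (hpX : Function.Periodic X 1)
    (hps : Function.Periodic s 1) (hpκ : Function.Periodic κ 1) : ∃ x, κ x = 0 := by
  by_contra! hne
  -- The derivative of `s/κ` is `w c + w (s/κ)²`, and `X` removes the first term. A monotone
  -- periodic function is constant, so `s` vanishes identically; then so does `κ c`, against `c² +
  -- s² = 1`.
  have hd : ∀ x, HasDerivAt (fun x => s x / κ x - X x) (w x * (s x / κ x) ^ 2) x := fun x =>
    (((h.hasDerivAt_sin x).fun_div (h.hasDerivAt_vel x) (hne x)).fun_sub (hX x)).congr_deriv (by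
      have := hne x
      field_simp
      ring)
  have hconst := Monotone.eq_of_periodic
    (monotone_of_hasDerivAt_nonneg hd fun x => mul_nonneg (hw x).le (sq_nonneg _))
    (fun x => by simp only [hps x, hpκ x, hpX x])
  have hs : ∀ x, s x = 0 := by
    intro x
    have h1 : HasDerivAt (fun x => s x / κ x - X x) 0 x := by
      rw [show (fun x => s x / κ x - X x) = fun _ => s 0 / κ 0 - X 0 from
        funext fun y => hconst y 0]
      exact hasDerivAt_const _ _
    have h2 := (hd x).unique h1
    simpa [(hw x).ne', hne x] using h2
  have hc : c 0 = 0 := by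
    have h1 : HasDerivAt s 0 0 := by
      rw [show s = fun _ => 0 from funext hs]
      exact hasDerivAt_const _ _
    simpa [(hw 0).ne', hne 0] using (h.hasDerivAt_sin 0).unique h1
  simpa [hc, hs 0] using h.sq_add_sq 0

/-- A pendulum at rest in an equilibrium stays there. The tangent is then constant, and `X` is
strictly monotone instead of periodic. -/
theorem sin_ne_zero_of_vel_eq_zero (h : IsPendulum w c s κ) (hφ : ∀ x, HasDerivAt φ (w x) x)
    (hw : ∀ x, 0 < w x) (hX : ∀ x, HasDerivAt X (w x * c x) x) (hpX : Function.Periodic X 1)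
    {x₀ : ℝ} (hκ : κ x₀ = 0) : s x₀ ≠ 0 := by
  intro hs
  have hsq : c x₀ ^ 2 = 1 := by simpa [hs] using h.sq_add_sq x₀
  have hrest : IsPendulum w (fun _ => c x₀) (fun _ => 0) (fun _ => 0) :=
    ⟨fun x => by simpa using hasDerivAt_const x (c x₀), fun x => by simpa using hasDerivAt_const x 0,
      fun x => by simpa using hasDerivAt_const x 0, fun x => by simpa using hsq⟩
  have hc : ∀ x, c x = c x₀ := fun x => (h.eq_of_eq_at hrest hφ hw rfl hs hκ x).1
  refine not_periodic_of_hasDerivAt_pos (f := fun x => c x₀ * X x)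
    (fun x => (hX x).const_mul _) (fun x => ?_) (fun x => by simp only [hpX x])
  rw [hc x, show c x₀ * (w x * c x₀) = w x * c x₀ ^ 2 by ring, hsq, mul_one]
  exact hw x

end IsPendulum

/-! ### The wavelike elastica -/

/-- The tangent of the wavelike elastica is `(1 - 2 m sn², 2 √m sn dn)`, its curvature `2 √m cn`. -/
theorem isPendulum_wavelike {m : ℝ} (hm0 : 0 ≤ m) (hm1 : m < 1) {w φ : ℝ → ℝ}
    (hφ : ∀ x, HasDerivAt φ (w x) x) :
    IsPendulum w (fun x => 1 - 2 * m * Real.sin (am (φ x) m) ^ 2)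
      (fun x => 2 * Real.sqrt m * Real.sin (am (φ x) m) *
        Real.sqrt (1 - m * Real.sin (am (φ x) m) ^ 2))
      (fun x => 2 * Real.sqrt m * Real.cos (am (φ x) m)) := by
  have hsm : Real.sqrt m ^ 2 = m := Real.sq_sqrt hm0
  have ha : ∀ x, HasDerivAt (fun x => am (φ x) m)
      (Real.sqrt (1 - m * Real.sin (am (φ x) m) ^ 2) * w x) x := fun x =>
    (hasDerivAt_am hm1 (φ x)).comp x (hφ x)
  have hdn : ∀ x, Real.sqrt (1 - m * Real.sin (am (φ x) m) ^ 2) ^ 2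
      = 1 - m * Real.sin (am (φ x) m) ^ 2 := fun x => Real.sq_sqrt (one_sub_mul_sin_sq_pos hm1 _).le
  refine ⟨fun x => ?_, fun x => ?_, fun x => ?_, fun x => ?_⟩
  · refine ((((ha x).sin.fun_pow 2).const_mul (2 * m)).const_sub 1).congr_deriv ?_
    push_cast
    linear_combination (-4 * w x * Real.cos (am (φ x) m) * Real.sin (am (φ x) m) *
      Real.sqrt (1 - m * Real.sin (am (φ x) m) ^ 2)) * -hsm
  · have hpos := one_sub_mul_sin_sq_pos hm1 (am (φ x) m)
    have hne := (Real.sqrt_pos.2 hpos).ne'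
    refine (((ha x).sin.const_mul (2 * Real.sqrt m)).fun_mul
      (((((ha x).sin.fun_pow 2).const_mul m).const_sub 1).sqrt hpos.ne')).congr_deriv ?_
    have h := hdn x
    set d := Real.sqrt (1 - m * Real.sin (am (φ x) m) ^ 2)
    field_simp
    push_cast
    linear_combination (2 * Real.sqrt m * Real.cos (am (φ x) m) * w x) * h
  · refine ((ha x).cos.const_mul (2 * Real.sqrt m)).congr_deriv ?_
    ring
  · have h := hdn x
    set d := Real.sqrt (1 - m * Real.sin (am (φ x) m) ^ 2)
    linear_combination (4 * Real.sin (am (φ x) m) ^ 2 * d ^ 2) * hsm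
      + (4 * m * Real.sin (am (φ x) m) ^ 2) * h

theorem hasDerivAt_wavelike_zero {m : ℝ} (hm1 : m < 1) (s : ℝ) :
    HasDerivAt (fun s => wavelike m s 0) (1 - 2 * m * Real.sin (am s m) ^ 2) s := by
  have h := ((((hasDerivAt_ellipticE m (am s m)).comp s (hasDerivAt_am hm1 s)).const_mul 2).fun_sub
    (hasDerivAt_id s))
  refine h.congr_deriv ?_
  rw [Real.mul_self_sqrt (one_sub_mul_sin_sq_pos hm1 _).le]
  ring

theorem hasDerivAt_wavelike_one {m : ℝ} (hm1 : m < 1) (s : ℝ) :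
    HasDerivAt (fun s => wavelike m s 1) (2 * Real.sqrt m * Real.sin (am s m) *
        Real.sqrt (1 - m * Real.sin (am s m) ^ 2)) s :=
  ((hasDerivAt_am hm1 s).cos.const_mul (-2 * Real.sqrt m)).congr_deriv (by ring)

/-- A wavelike elastica closes up only for the figure-eight parameter, after full periods. -/
theorem wavelike_closed {m : ℝ} (hm0 : 0 < m) (hm1 : m < 1) {P : ℝ} (hP : 0 < P)
    (h : wavelike m P = wavelike m 0) :
    IsFigureEightParameter m ∧ ∃ μ : ℕ, 1 ≤ μ ∧ P = μ * (4 * completeK m) := by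
  have hX := congrFun (congrArg WithLp.ofLp h) 0
  have hY := congrFun (congrArg WithLp.ofLp h) 1
  simp only [wavelike, cn, am_zero hm1, ellipticE_zero] at hX hY
  simp [(Real.sqrt_pos.2 hm0).ne'] at hX hY
  -- The second coordinate alone gives `cn P = 1`, hence a whole number of periods; the first
  -- coordinate then gives `8nE = 4nK`.
  obtain ⟨n, hn⟩ := (Real.cos_eq_one_iff _).1 hY
  have hPn : P = n * (4 * completeK m) := by
    rw [← ellipticF_int_mul_two_pi hm1, hn, ellipticF_am hm1]
  have hK := completeK_pos hm1
  have hnpos : (0 : ℝ) < n := by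
    rw [hPn] at hP
    exact (pos_iff_pos_of_mul_pos hP).2 (by positivity)
  rw [← hn, ellipticE_int_mul_two_pi, hPn] at hX
  refine ⟨⟨hm0, hm1, ?_⟩, n.toNat, ?_, ?_⟩
  · have : (n : ℝ) * 4 * (2 * completeE m - completeK m) = 0 := by linarith
    have h4 : (n : ℝ) * 4 ≠ 0 := by positivity
    exact sub_eq_zero.1 ((mul_eq_zero.1 this).resolve_left h4)
  · have : 0 < n := by exact_mod_cast hnpos
    omega
  · have : 0 ≤ n := by exact_mod_cast hnpos.le
    rw [hPn]
    congr 1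
    exact_mod_cast (Int.toNat_of_nonneg this).symm

theorem advance_of_periodic_deriv {φ w : ℝ → ℝ} (hφ : ∀ x, HasDerivAt φ (w x) x)
    (hpw : Function.Periodic w 1) (x : ℝ) : φ (x + 1) = φ x + (φ 1 - φ 0) := by
  have h : ∀ x, HasDerivAt (fun x => φ (x + 1) - φ x) 0 x := fun x =>
    (((hφ (x + 1)).comp_add_const x 1).fun_sub (hφ x)).congr_deriv (by rw [hpw x, sub_self])
  have := eq_of_hasDerivAt_zero h x 0
  simp only [zero_add] at this
  linarith

theorem surjective_of_advance {φ : ℝ → ℝ} {P : ℝ} (hc : Continuous φ) (hP : 0 < P)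
    (h : ∀ x, φ (x + 1) = φ x + P) : Function.Surjective φ := by
  refine surjective_of_arithmetic_progression hc (u := fun n => (n : ℝ)) (b := φ 0) hP fun n => ?_
  induction n using Int.induction_on with
  | zero => simp
  | succ n ih => push_cast at ih ⊢; rw [h, ih]; ring
  | pred n ih =>
    have := h (-(n : ℝ) - 1)
    rw [sub_add_cancel] at this
    push_cast at ih ⊢
    linarith

/-- A closed curve whose tangent moves like a pendulum is, up to a reflection, a wavelike elastica
with figure-eight parameter. -/
theorem IsPendulum.exists_wavelike {w c s κ X Y φ₀ : ℝ → ℝ} (h : IsPendulum w c s κ)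
    (hφ₀ : ∀ x, HasDerivAt φ₀ (w x) x) (hw : ∀ x, 0 < w x)
    (hX : ∀ x, HasDerivAt X (w x * c x) x) (hY : ∀ x, HasDerivAt Y (w x * s x) x)
    (hpX : Function.Periodic X 1) (hpY : Function.Periodic Y 1)
    (hps : Function.Periodic s 1) (hpκ : Function.Periodic κ 1) (hpw : Function.Periodic w 1) :
    ∃ (m : ℝ) (a ε : ℝ) (μ : ℕ) (X₀ Y₀ : ℝ), IsFigureEightParameter m ∧ ε ^ 2 = 1 ∧ 1 ≤ μ ∧
      (∀ x, φ₀ (x + 1) = φ₀ x + μ * (4 * completeK m)) ∧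
      (∀ x, X x = X₀ + wavelike m (φ₀ x + a) 0) ∧
      (∀ x, Y x = Y₀ + ε * wavelike m (φ₀ x + a) 1) := by
  obtain ⟨x₀, hκ₀⟩ := h.exists_vel_eq_zero hw hX hpX hps hpκ
  have hs₀ := h.sin_ne_zero_of_vel_eq_zero hφ₀ hw hX hpX hκ₀
  obtain ⟨ε, hε, hεs, hε'⟩ : ∃ ε : ℝ, ε ^ 2 = 1 ∧ 0 < ε * s x₀ ∧
      IsPendulum w c (fun x => ε * s x) (fun x => ε * κ x) := by
    rcases hs₀.lt_or_gt with hs | hs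
    · exact ⟨-1, by norm_num, by linarith, by simpa using h.neg⟩
    · exact ⟨1, by norm_num, by linarith, by simpa using h⟩
  have hsq := h.sq_add_sq x₀
  have hspos : 0 < s x₀ ^ 2 := by positivity
  -- At amplitude `π/2` the wavelike tangent has first component `1 - 2m`, which must equal `c x₀`.
  -- Since `s x₀ ≠ 0`, `|c x₀| < 1` and `m` lies in `(0,1)`.
  set m : ℝ := (1 - c x₀) / 2 with hm
  have hm0 : 0 < m := by nlinarith
  have hm1 : m < 1 := by nlinarith
  -- The shift that takes `x₀` to the quarter period, where the wavelike curvature vanishes.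
  set a : ℝ := completeK m - φ₀ x₀ with ha
  have hφ : ∀ x, HasDerivAt (fun x => φ₀ x + a) (w x) x := fun x => (hφ₀ x).add_const a
  have hφx₀ : am (φ₀ x₀ + a) m = Real.pi / 2 := by
    rw [ha, add_sub_cancel, am_completeK hm1]
  have heq := hε'.eq_of_eq_at (isPendulum_wavelike hm0.le hm1 hφ) hφ hw (x₀ := x₀)
    (by simp only [hφx₀, Real.sin_pi_div_two]; linear_combination -2 * hm)
    (by
      simp only [hφx₀, Real.sin_pi_div_two]
      -- Both sines are nonnegative, the left one by the choice of `ε`, so it is enough to compare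
      -- squares.
      refine (pow_left_inj₀ hεs.le (by positivity) two_ne_zero).1 ?_
      rw [mul_pow, hε, mul_pow, mul_pow, mul_pow, Real.sq_sqrt hm0.le, Real.sq_sqrt (by linarith),
        hm]
      linear_combination hsq)
    (by simp only [hφx₀, Real.cos_pi_div_two, hκ₀, mul_zero])
  have hX' : ∀ x, X x = X 0 - wavelike m (φ₀ 0 + a) 0 + wavelike m (φ₀ x + a) 0 := by
    intro x
    have hd : ∀ x, HasDerivAt (fun x => X x - wavelike m (φ₀ x + a) 0) 0 x := fun x =>
      ((hX x).fun_sub (HasDerivAt.comp (h₂ := fun s => wavelike m s 0) x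
        (hasDerivAt_wavelike_zero hm1 (φ₀ x + a)) (hφ x))).congr_deriv
        (by rw [(heq x).1]; ring)
    linarith [eq_of_hasDerivAt_zero hd x 0]
  have hY' : ∀ x, ε * Y x = ε * Y 0 - wavelike m (φ₀ 0 + a) 1 + wavelike m (φ₀ x + a) 1 := by
    intro x
    have hd : ∀ x, HasDerivAt (fun x => ε * Y x - wavelike m (φ₀ x + a) 1) 0 x := fun x =>
      (((hY x).const_mul ε).fun_sub
        (HasDerivAt.comp (h₂ := fun s => wavelike m s 1) x
        (hasDerivAt_wavelike_one hm1 (φ₀ x + a)) (hφ x))).congr_deriv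
        (by rw [← (heq x).2.1]; ring)
    linarith [eq_of_hasDerivAt_zero hd x 0]
  have hadv := advance_of_periodic_deriv hφ₀ hpw
  have hP : 0 < φ₀ 1 - φ₀ 0 := sub_pos.2 (strictMono_of_hasDerivAt_pos hφ₀ hw one_pos)
  -- The point with wavelike parameter `0`; periodicity of the curve there compares `wavelike m` at
  -- `0` and at `P`.
  obtain ⟨x₁, hx₁⟩ := surjective_of_advance
    (continuous_iff_continuousAt.2 fun x => (hφ₀ x).continuousAt) hP hadv (-a)
  obtain ⟨hfig, μ, hμ, hPμ⟩ := wavelike_closed hm0 hm1 hP (by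
    have h0 := hX' (x₁ + 1)
    have h1 := hY' (x₁ + 1)
    rw [hpX x₁, hX' x₁, hadv, hx₁, neg_add_cancel, add_right_comm, neg_add_cancel, zero_add] at h0
    rw [hpY x₁, hY' x₁, hadv, hx₁, neg_add_cancel, add_right_comm, neg_add_cancel, zero_add] at h1
    ext i
    fin_cases i
    · exact (add_left_cancel h0).symm
    · exact (add_left_cancel h1).symm)
  refine ⟨m, a, ε, μ, _, Y 0 - ε * wavelike m (φ₀ 0 + a) 1, hfig, hε, hμ, fun x => ?_, hX',
    fun x => ?_⟩
  · rw [hadv, hPμ]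
  · linear_combination ε * hY' x - (Y x - Y 0) * hε

/-! ### The moving frame of a planar elastica -/

theorem contDiff_arcDeriv {n : ℕ} {γ ψ : ℝ → EuclideanSpace ℝ (Fin n)} (hγ : ContDiff ℝ ∞ γ)
    (him : ∀ x, deriv γ x ≠ 0) (hψ : ContDiff ℝ ∞ ψ) : ContDiff ℝ ∞ (arcDeriv γ ψ) :=
  (((contDiff_infty_iff_deriv.1 hγ).2.norm ℝ him).inv fun x => norm_ne_zero_iff.2 (him x)).smul
    (contDiff_infty_iff_deriv.1 hψ).2

theorem hasDerivAt_coord {n : ℕ} {γ ψ : ℝ → EuclideanSpace ℝ (Fin n)}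
    (him : ∀ x, deriv γ x ≠ 0) (hψ : ContDiff ℝ ∞ ψ) (i : Fin n) (x : ℝ) :
    HasDerivAt (fun x => ψ x i) (‖deriv γ x‖ * arcDeriv γ ψ x i) x := by
  have h := (EuclideanSpace.proj i : EuclideanSpace ℝ (Fin n) →L[ℝ] ℝ).hasFDerivAt.comp_hasDerivAt x
    ((contDiff_infty_iff_deriv.1 hψ).1 x).hasDerivAt
  refine h.congr_deriv ?_
  simp [arcDeriv, him x]

theorem periodic_deriv {n : ℕ} {ψ : ℝ → EuclideanSpace ℝ (Fin n)} (hψ : Function.Periodic ψ 1) :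
    Function.Periodic (deriv ψ) 1 := fun x => by
  rw [← deriv_comp_add_const, show (fun x => ψ (x + 1)) = ψ from funext hψ]

theorem periodic_arcDeriv {n : ℕ} {γ ψ : ℝ → EuclideanSpace ℝ (Fin n)}
    (hγ : Function.Periodic γ 1) (hψ : Function.Periodic ψ 1) :
    Function.Periodic (arcDeriv γ ψ) 1 := fun x => by
  simp only [arcDeriv, periodic_deriv hγ x, periodic_deriv hψ x]

/-- `(T₀, T₁)` is the tangent, `v` the speed, `k` the curvature with arclength derivative `k'`
of the closed planar curve `(X, Y)`, and `(V₀, V₁)` is its conserved force vector. -/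
structure IsElasticFrame (lam V₀ V₁ : ℝ) (v X Y T₀ T₁ k k' : ℝ → ℝ) : Prop where
  speed_pos : ∀ x, 0 < v x
  contDiff_speed : ContDiff ℝ ∞ v
  hasDerivAt_fst : ∀ x, HasDerivAt X (v x * T₀ x) x
  hasDerivAt_snd : ∀ x, HasDerivAt Y (v x * T₁ x) x
  sq_add_sq : ∀ x, T₀ x ^ 2 + T₁ x ^ 2 = 1
  hasDerivAt_tangent_fst : ∀ x, HasDerivAt T₀ (-(v x * k x * T₁ x)) x
  hasDerivAt_tangent_snd : ∀ x, HasDerivAt T₁ (v x * k x * T₀ x) x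
  hasDerivAt_curvature : ∀ x, HasDerivAt k (v x * k' x) x
  force_fst : ∀ x, (k x ^ 2 - lam) * T₀ x - 2 * k' x * T₁ x = V₀
  force_snd : ∀ x, (k x ^ 2 - lam) * T₁ x + 2 * k' x * T₀ x = V₁
  periodic_speed : Function.Periodic v 1
  periodic_fst : Function.Periodic X 1
  periodic_snd : Function.Periodic Y 1
  periodic_tangent_fst : Function.Periodic T₀ 1
  periodic_tangent_snd : Function.Periodic T₁ 1
  periodic_curvature : Function.Periodic k 1

/-- The left side of the elastica equation is the arclength derivative of `2γ_sss + 3|γ_ss|²γ_s -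
λγ_s`. Differentiating `|T|² = 1` twice gives `T·γ_ss = 0` and `T·γ_sss = -|γ_ss|²`, which turns
this constant vector into its expression in the frame. -/
theorem IsElasticaWith.exists_isElasticFrame {lam : ℝ} {γ : ℝ → EuclideanSpace ℝ (Fin 2)}
    (h : IsElasticaWith lam γ) (hp : Function.Periodic γ 1) :
    ∃ (V₀ V₁ : ℝ) (v T₀ T₁ k k' : ℝ → ℝ),
      IsElasticFrame lam V₀ V₁ v (fun x => γ x 0) (fun x => γ x 1) T₀ T₁ k k' := by
  obtain ⟨hγ, him, heq⟩ := h
  have hvpos : ∀ x, 0 < ‖deriv γ x‖ := fun x => norm_pos_iff.2 (him x)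
  have hT := contDiff_arcDeriv hγ him hγ
  have hA := contDiff_arcDeriv hγ him hT
  have hB := contDiff_arcDeriv hγ him hA
  have dγ := hasDerivAt_coord him hγ
  have dT := hasDerivAt_coord him hT
  have dA := hasDerivAt_coord him hA
  have dB := hasDerivAt_coord him hB
  have pT := periodic_arcDeriv hp hp
  have pA := periodic_arcDeriv hp pT
  have hunit : ∀ x, arcDeriv γ γ x 0 ^ 2 + arcDeriv γ γ x 1 ^ 2 = 1 := by
    intro x
    have h1 : ‖arcDeriv γ γ x‖ = 1 := by
      rw [arcDeriv, norm_smul, norm_inv, norm_norm, inv_mul_cancel₀ (hvpos x).ne']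
    have h2 := EuclideanSpace.real_norm_sq_eq (arcDeriv γ γ x)
    rw [Fin.sum_univ_two, h1] at h2
    linarith
  change ∀ x, (2 : ℝ) • arcDeriv γ (arcDeriv γ (arcDeriv γ (arcDeriv γ γ))) x
      + (6 * inner ℝ (arcDeriv γ (arcDeriv γ γ) x) (arcDeriv γ (arcDeriv γ (arcDeriv γ γ)) x)) •
        arcDeriv γ γ x
      + (3 * ‖arcDeriv γ (arcDeriv γ γ) x‖ ^ 2) • arcDeriv γ (arcDeriv γ γ) x
      - lam • arcDeriv γ (arcDeriv γ γ) x = 0 at heq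
  have heq' : ∀ x i, _ := fun x i => congrFun (congrArg WithLp.ofLp (heq x)) i
  simp only [EuclideanSpace.real_norm_sq_eq, PiLp.inner_apply, Fin.sum_univ_two, PiLp.add_apply,
    PiLp.sub_apply, PiLp.smul_apply, smul_eq_mul, PiLp.zero_apply, RCLike.inner_apply,
    conj_trivial] at heq'
  clear heq
  generalize arcDeriv γ (arcDeriv γ (arcDeriv γ (arcDeriv γ γ))) = C at *
  generalize arcDeriv γ (arcDeriv γ (arcDeriv γ γ)) = B at *
  generalize arcDeriv γ (arcDeriv γ γ) = A at *
  generalize arcDeriv γ γ = T at *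
  have hTA : ∀ x, T x 0 * A x 0 + T x 1 * A x 1 = 0 := by
    intro x
    have h1 := ((dT 0 x).fun_pow 2).fun_add ((dT 1 x).fun_pow 2)
    simp only [hunit] at h1
    have h2 := h1.unique (hasDerivAt_const x 1)
    have h3 : ‖deriv γ x‖ * 2 * (T x 0 * A x 0 + T x 1 * A x 1) = 0 := by
      rw [← h2]; push_cast; ring
    exact (mul_eq_zero.1 h3).resolve_left (by have := hvpos x; positivity)
  have hTB : ∀ x, T x 0 * B x 0 + T x 1 * B x 1 = -(A x 0 ^ 2 + A x 1 ^ 2) := by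
    intro x
    have h1 := ((dT 0 x).fun_mul (dA 0 x)).fun_add ((dT 1 x).fun_mul (dA 1 x))
    simp only [hTA] at h1
    have h2 := h1.unique (hasDerivAt_const x 0)
    have h3 : ‖deriv γ x‖ *
        (A x 0 ^ 2 + A x 1 ^ 2 + (T x 0 * B x 0 + T x 1 * B x 1)) = 0 := by
      rw [← h2]; ring
    linarith [(mul_eq_zero.1 h3).resolve_left (hvpos x).ne']
  have hV : ∀ i x, HasDerivAt (fun x => 2 * B x i + 3 * (A x 0 ^ 2 + A x 1 ^ 2) * T x i
      - lam * T x i) 0 x := by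
    intro i x
    refine ((((dB i x).const_mul 2).fun_add (((((dA 0 x).fun_pow 2).fun_add
      ((dA 1 x).fun_pow 2)).const_mul 3).fun_mul (dT i x))).fun_sub
        ((dT i x).const_mul lam)).congr_deriv ?_
    push_cast
    linear_combination ‖deriv γ x‖ * heq' x i
  have hVc := fun i x => eq_of_hasDerivAt_zero (hV i) x 0
  refine ⟨_, _, fun x => ‖deriv γ x‖, fun x => T x 0, fun x => T x 1,
    -- Curvature is the determinant of `T` and `A = T_s`; in its derivative the determinant of `A`
    -- with itself drops out.
    fun x => T x 0 * A x 1 - T x 1 * A x 0, fun x => T x 0 * B x 1 - T x 1 * B x 0,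
    { speed_pos := hvpos
      contDiff_speed := (contDiff_infty_iff_deriv.1 hγ).2.norm ℝ him
      hasDerivAt_fst := dγ 0
      hasDerivAt_snd := dγ 1
      sq_add_sq := hunit
      hasDerivAt_tangent_fst := fun x => (dT 0 x).congr_deriv ?_
      hasDerivAt_tangent_snd := fun x => (dT 1 x).congr_deriv ?_
      hasDerivAt_curvature := fun x => (((dT 0 x).fun_mul (dA 1 x)).fun_sub
        ((dT 1 x).fun_mul (dA 0 x))).congr_deriv (by ring)
      force_fst := fun x => Eq.trans ?_ (hVc 0 x)
      force_snd := fun x => Eq.trans ?_ (hVc 1 x)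
      periodic_speed := fun x => by simp only [periodic_deriv hp x]
      periodic_fst := fun x => by simp only [hp x]
      periodic_snd := fun x => by simp only [hp x]
      periodic_tangent_fst := fun x => by simp only [pT x]
      periodic_tangent_snd := fun x => by simp only [pT x]
      periodic_curvature := fun x => by simp only [pT x, pA x] }⟩
  · linear_combination ‖deriv γ x‖ * (-A x 0 * hunit x + T x 0 * hTA x)
  · linear_combination ‖deriv γ x‖ * (-A x 1 * hunit x + T x 1 * hTA x)
  · linear_combination 2 * B x 0 * hunit x - 2 * T x 0 * hTB x
      - T x 0 * (T x 0 * A x 0 + T x 1 * A x 1) * hTA x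
      + T x 0 * (A x 0 ^ 2 + A x 1 ^ 2) * hunit x
  · linear_combination 2 * B x 1 * hunit x - 2 * T x 1 * hTB x
      - T x 1 * (T x 0 * A x 0 + T x 1 * A x 1) * hTA x
      + T x 1 * (A x 0 ^ 2 + A x 1 ^ 2) * hunit x

/-! ### Similarities and covers -/

/-- The linear isometry of the plane sending the standard basis to `(e₀, e₁)` and
`ε (-e₁, e₀)`. -/
theorem exists_linearIsometryEquiv {e₀ e₁ ε : ℝ} (he : e₀ ^ 2 + e₁ ^ 2 = 1) (hε : ε ^ 2 = 1) :
    ∃ A : EuclideanSpace ℝ (Fin 2) ≃ₗᵢ[ℝ] EuclideanSpace ℝ (Fin 2),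
      ∀ p, A p = !₂[e₀ * p 0 - ε * e₁ * p 1, e₁ * p 0 + ε * e₀ * p 1] := by
  let f : EuclideanSpace ℝ (Fin 2) →ₗ[ℝ] EuclideanSpace ℝ (Fin 2) :=
    { toFun := fun p => !₂[e₀ * p 0 - ε * e₁ * p 1, e₁ * p 0 + ε * e₀ * p 1]
      map_add' := fun p q => by ext i; fin_cases i <;> simp <;> ring
      map_smul' := fun r p => by ext i; fin_cases i <;> simp <;> ring }
  have hf : ∀ p, ‖f p‖ = ‖p‖ := by
    intro p
    refine (pow_left_inj₀ (norm_nonneg _) (norm_nonneg _) two_ne_zero).1 ?_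
    rw [EuclideanSpace.real_norm_sq_eq, EuclideanSpace.real_norm_sq_eq, Fin.sum_univ_two,
      Fin.sum_univ_two]
    change (e₀ * p 0 - ε * e₁ * p 1) ^ 2 + (e₁ * p 0 + ε * e₀ * p 1) ^ 2 = _
    linear_combination (p 0 ^ 2 + ε ^ 2 * p 1 ^ 2) * he + p 1 ^ 2 * hε
  exact ⟨LinearIsometry.toLinearIsometryEquiv ⟨f, hf⟩ rfl, fun p => rfl⟩

/-- `hX` and `hY` describe `γ` in the rotated frame `(e₀, e₁)`, `(-e₁, e₀)` scaled by `ρ`; inverting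
this rotation and scaling yields the similarity. -/
theorem isCoverOf_of_coords {μ : ℕ} {c : ℝ → EuclideanSpace ℝ (Fin 2)} {P : ℝ}
    {γ : UnitAddCircle → EuclideanSpace ℝ (Fin 2)} {e₀ e₁ ε ρ X₀ Y₀ : ℝ} {w φ : ℝ → ℝ}
    (he : e₀ ^ 2 + e₁ ^ 2 = 1) (hε : ε ^ 2 = 1) (hρ : 0 < ρ) (hw : ∀ x, 0 < w x)
    (hws : ContDiff ℝ ∞ w) (hφ : ∀ x, HasDerivAt φ (w x) x) (hP : ∀ x, φ (x + 1) = φ x + μ * P)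
    (hX : ∀ x : ℝ, ρ * (e₀ * γ x 0 + e₁ * γ x 1) = X₀ + c (φ x) 0)
    (hY : ∀ x : ℝ, ρ * (e₀ * γ x 1 - e₁ * γ x 0) = Y₀ + ε * c (φ x) 1) :
    IsCoverOf μ c P γ := by
  obtain ⟨A, hA⟩ := exists_linearIsometryEquiv he hε
  refine ⟨!₂[ρ⁻¹ * (e₀ * X₀ - e₁ * Y₀), ρ⁻¹ * (e₁ * X₀ + e₀ * Y₀)], ρ⁻¹, A, φ, inv_pos.2 hρ,
    contDiff_infty_iff_deriv.2 ⟨fun x => (hφ x).differentiableAt, ?_⟩, fun x => ?_, hP, fun x => ?_⟩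
  · rwa [show deriv φ = w from funext fun x => (hφ x).deriv]
  · rw [(hφ x).deriv]; exact hw x
  · have hρ' := hρ.ne'
    rw [hA]
    ext i
    fin_cases i
    · simp
      field_simp
      linear_combination e₀ * hX x - e₁ * hY x - ρ * γ x 0 * he
    · simp
      field_simp
      linear_combination e₁ * hX x + e₀ * hY x - ρ * γ x 1 * he

theorem exists_primitive {w : ℝ → ℝ} (hw : Continuous w) :
    ∃ φ : ℝ → ℝ, φ 0 = 0 ∧ ∀ x, HasDerivAt φ (w x) x :=
  ⟨fun x => ∫ t in (0 : ℝ)..x, w t, by simp, fun x =>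
    intervalIntegral.integral_hasDerivAt_right (hw.intervalIntegrable _ _)
      (hw.stronglyMeasurableAtFilter _ _) hw.continuousAt⟩

/-! ### The classification -/

namespace IsElasticFrame

variable {lam V₀ V₁ : ℝ} {v T₀ T₁ k k' : ℝ → ℝ} {γ : UnitAddCircle → EuclideanSpace ℝ (Fin 2)}

/-- A closed elastica with nonzero force is a figure-eight elastica. -/
theorem exists_isFigureEight
    (h : IsElasticFrame lam V₀ V₁ v (fun x => γ x 0) (fun x => γ x 1) T₀ T₁ k k')
    (hV : V₀ ^ 2 + V₁ ^ 2 ≠ 0) : ∃ (m : ℝ) (μ : ℕ), 1 ≤ μ ∧ IsFigureEight μ m γ := by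
  -- Writing `|V| = 2ρ²`, the normal component of the force gives `k' = -ρ² s`. Dilating the curve
  -- by `ρ` normalizes this to the pendulum with unit coefficient, with velocity `k / ρ`.
  obtain ⟨ρ, hρ, hρ4⟩ : ∃ ρ : ℝ, 0 < ρ ∧ (2 * ρ ^ 2) ^ 2 = V₀ ^ 2 + V₁ ^ 2 := by
    have hpos : 0 < V₀ ^ 2 + V₁ ^ 2 := lt_of_le_of_ne (by positivity) hV.symm
    refine ⟨Real.sqrt (Real.sqrt (V₀ ^ 2 + V₁ ^ 2) / 2), by positivity, ?_⟩
    rw [Real.sq_sqrt (by positivity), mul_div_cancel₀ _ two_ne_zero, Real.sq_sqrt hpos.le]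
  have hρ' := hρ.ne'
  obtain ⟨e₀, he₀⟩ : ∃ e₀ : ℝ, V₀ = 2 * ρ ^ 2 * e₀ := ⟨V₀ / (2 * ρ ^ 2), by field_simp⟩
  obtain ⟨e₁, he₁⟩ : ∃ e₁ : ℝ, V₁ = 2 * ρ ^ 2 * e₁ := ⟨V₁ / (2 * ρ ^ 2), by field_simp⟩
  have he : e₀ ^ 2 + e₁ ^ 2 = 1 := by
    have h4 : (2 * ρ ^ 2) ^ 2 ≠ 0 := by positivity
    refine mul_left_cancel₀ h4 ?_
    rw [mul_one]
    nth_rewrite 2 [hρ4]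
    rw [he₀, he₁]
    ring
  have hw : ∀ x, 0 < ρ * v x := fun x => mul_pos hρ (h.speed_pos x)
  have hws : ContDiff ℝ ∞ fun x => ρ * v x := contDiff_const.mul h.contDiff_speed
  obtain ⟨φ, -, hφ⟩ := exists_primitive hws.continuous
  have hpen : IsPendulum (fun x => ρ * v x) (fun x => e₀ * T₀ x + e₁ * T₁ x)
      (fun x => e₀ * T₁ x - e₁ * T₀ x) (fun x => k x / ρ) :=
    { hasDerivAt_cos := fun x => (((h.hasDerivAt_tangent_fst x).const_mul e₀).fun_add
        ((h.hasDerivAt_tangent_snd x).const_mul e₁)).congr_deriv (by field_simp; ring)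
      hasDerivAt_sin := fun x => (((h.hasDerivAt_tangent_snd x).const_mul e₀).fun_sub
        ((h.hasDerivAt_tangent_fst x).const_mul e₁)).congr_deriv (by field_simp; ring)
      hasDerivAt_vel := fun x => ((h.hasDerivAt_curvature x).div_const ρ).congr_deriv (by
        have h0 := h.force_fst x
        have h1 := h.force_snd x
        rw [he₀] at h0
        rw [he₁] at h1
        field_simp
        linear_combination (v x / 2) * (T₀ x * h1 - T₁ x * h0)
          - v x * k' x * h.sq_add_sq x)
      sq_add_sq := fun x => by
        linear_combination (T₀ x ^ 2 + T₁ x ^ 2) * he + h.sq_add_sq x }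
  obtain ⟨m, a, ε, μ, X₀, Y₀, hfig, hε, hμ, hP, hX, hY⟩ := hpen.exists_wavelike hφ hw
    (X := fun x => ρ * (e₀ * γ x 0 + e₁ * γ x 1)) (Y := fun x => ρ * (e₀ * γ x 1 - e₁ * γ x 0))
    (fun x => ((((h.hasDerivAt_fst x).const_mul e₀).fun_add
      ((h.hasDerivAt_snd x).const_mul e₁)).const_mul ρ).congr_deriv (by ring))
    (fun x => ((((h.hasDerivAt_snd x).const_mul e₀).fun_sub
      ((h.hasDerivAt_fst x).const_mul e₁)).const_mul ρ).congr_deriv (by ring))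
    (fun x => by
      have h0 := h.periodic_fst x
      have h1 := h.periodic_snd x
      simp only at h0 h1 ⊢
      rw [h0, h1])
    (fun x => by
      have h0 := h.periodic_fst x
      have h1 := h.periodic_snd x
      simp only at h0 h1 ⊢
      rw [h0, h1])
    (fun x => by simp only [h.periodic_tangent_fst x, h.periodic_tangent_snd x])
    (fun x => by simp only [h.periodic_curvature x])
    (fun x => by simp only [h.periodic_speed x])
  exact ⟨m, μ, hμ, hfig, isCoverOf_of_coords he hε hρ hw hws (φ := fun x => φ x + a)
    (fun x => (hφ x).add_const a) (fun x => by rw [hP]; ring) hX hY⟩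

/-- A closed elastica with zero force is a round circle. -/
theorem exists_isCircle
    (h : IsElasticFrame lam V₀ V₁ v (fun x => γ x 0) (fun x => γ x 1) T₀ T₁ k k')
    (hV : V₀ ^ 2 + V₁ ^ 2 = 0) : ∃ μ : ℕ, 1 ≤ μ ∧ IsCircle μ γ := by
  have hV₀ : V₀ = 0 := by nlinarith [sq_nonneg V₀, sq_nonneg V₁]
  have hV₁ : V₁ = 0 := by nlinarith [sq_nonneg V₀, sq_nonneg V₁]
  have hk' : ∀ x, k' x = 0 := by
    intro x
    have h0 := h.force_fst x
    have h1 := h.force_snd x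
    rw [hV₀] at h0
    rw [hV₁] at h1
    linear_combination (T₀ x * h1 - T₁ x * h0) / 2 - k' x * h.sq_add_sq x
  obtain ⟨κ, hκ⟩ : ∃ κ, ∀ x, k x = κ :=
    ⟨k 0, fun x => eq_of_hasDerivAt_zero
      (fun x => (h.hasDerivAt_curvature x).congr_deriv (by rw [hk', mul_zero])) x 0⟩
  have hT₀ : ∀ x, HasDerivAt T₀ (-(v x * κ * T₁ x)) x := fun x => by
    simpa only [hκ] using h.hasDerivAt_tangent_fst x
  have hT₁ : ∀ x, HasDerivAt T₁ (v x * κ * T₀ x) x := fun x => by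
    simpa only [hκ] using h.hasDerivAt_tangent_snd x
  obtain ⟨e₀, he₀⟩ : ∃ e₀, e₀ = T₀ 0 := ⟨_, rfl⟩
  obtain ⟨e₁, he₁⟩ : ∃ e₁, e₁ = T₁ 0 := ⟨_, rfl⟩
  have he : e₀ ^ 2 + e₁ ^ 2 = 1 := by rw [he₀, he₁, h.sq_add_sq]
  have hX : ∀ x, HasDerivAt (fun x : ℝ => e₀ * γ x 0 + e₁ * γ x 1)
      (v x * (e₀ * T₀ x + e₁ * T₁ x)) x := fun x => (((h.hasDerivAt_fst x).const_mul e₀).fun_add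
      ((h.hasDerivAt_snd x).const_mul e₁)).congr_deriv (by ring)
  have hY : ∀ x, HasDerivAt (fun x : ℝ => e₀ * γ x 1 - e₁ * γ x 0)
      (v x * (e₀ * T₁ x - e₁ * T₀ x)) x := fun x => (((h.hasDerivAt_snd x).const_mul e₀).fun_sub
      ((h.hasDerivAt_fst x).const_mul e₁)).congr_deriv (by ring)
  -- Zero curvature would give a straight line, whose coordinate along its own direction is not
  -- periodic.
  have hκ0 : κ ≠ 0 := by
    rintro rfl
    have hc₀ : ∀ x, T₀ x = e₀ := fun x => he₀ ▸ eq_of_hasDerivAt_zero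
      (fun x => (hT₀ x).congr_deriv (by ring)) x 0
    have hc₁ : ∀ x, T₁ x = e₁ := fun x => he₁ ▸ eq_of_hasDerivAt_zero
      (fun x => (hT₁ x).congr_deriv (by ring)) x 0
    refine not_periodic_of_hasDerivAt_pos hX (fun x => ?_) fun x => ?_
    · rw [hc₀, hc₁, show e₀ * e₀ + e₁ * e₁ = 1 by linarith, mul_one]
      exact h.speed_pos x
    · have h0 := h.periodic_fst x
      have h1 := h.periodic_snd x
      simp only at h0 h1 ⊢
      rw [h0, h1]
  obtain ⟨ε, ρ, hε, hρ, rfl⟩ : ∃ ε ρ : ℝ, ε ^ 2 = 1 ∧ 0 < ρ ∧ κ = ε * ρ := by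
    rcases hκ0.lt_or_gt with hs | hs
    · exact ⟨-1, -κ, by norm_num, by linarith, by ring⟩
    · exact ⟨1, κ, by norm_num, hs, by ring⟩
  have hw : ∀ x, 0 < ρ * v x := fun x => mul_pos hρ (h.speed_pos x)
  have hws : ContDiff ℝ ∞ fun x => ρ * v x := contDiff_const.mul h.contDiff_speed
  obtain ⟨φ, hφ0, hφ⟩ := exists_primitive hws.continuous
  -- In the frame given by the initial tangent, and up to the orientation `ε`, the tangent turned
  -- back by the angle `φ` is constant. `hC` and `hS` are the components of this fact; solving them
  -- gives `hcos` and `hsin`.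
  have hC : ∀ x, (e₀ * T₀ x + e₁ * T₁ x) * Real.cos (φ x)
      + ε * (e₀ * T₁ x - e₁ * T₀ x) * Real.sin (φ x) = 1 := by
    intro x
    have hd : ∀ x, HasDerivAt (fun x => (e₀ * T₀ x + e₁ * T₁ x) * Real.cos (φ x)
        + ε * (e₀ * T₁ x - e₁ * T₀ x) * Real.sin (φ x)) 0 x := fun x =>
      (((((hT₀ x).const_mul e₀).fun_add ((hT₁ x).const_mul e₁)).fun_mul (hφ x).cos).fun_add
        (((((hT₁ x).const_mul e₀).fun_sub ((hT₀ x).const_mul e₁)).const_mul ε).fun_mul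
          (hφ x).sin)).congr_deriv (by
        linear_combination (ρ * v x * Real.sin (φ x) * (e₀ * T₀ x + e₁ * T₁ x)) * hε)
    rw [eq_of_hasDerivAt_zero hd x 0, hφ0, ← he₀, ← he₁, Real.cos_zero, Real.sin_zero]
    linear_combination he
  have hS : ∀ x, (e₀ * T₀ x + e₁ * T₁ x) * Real.sin (φ x)
      - ε * (e₀ * T₁ x - e₁ * T₀ x) * Real.cos (φ x) = 0 := by
    intro x
    have hd : ∀ x, HasDerivAt (fun x => (e₀ * T₀ x + e₁ * T₁ x) * Real.sin (φ x)
        - ε * (e₀ * T₁ x - e₁ * T₀ x) * Real.cos (φ x)) 0 x := fun x =>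
      (((((hT₀ x).const_mul e₀).fun_add ((hT₁ x).const_mul e₁)).fun_mul (hφ x).sin).fun_sub
        (((((hT₁ x).const_mul e₀).fun_sub ((hT₀ x).const_mul e₁)).const_mul ε).fun_mul
          (hφ x).cos)).congr_deriv (by
        linear_combination (-ρ * v x * Real.cos (φ x) * (e₀ * T₀ x + e₁ * T₁ x)) * hε)
    rw [eq_of_hasDerivAt_zero hd x 0, hφ0, ← he₀, ← he₁, Real.cos_zero, Real.sin_zero]
    ring
  have hcos : ∀ x, e₀ * T₀ x + e₁ * T₁ x = Real.cos (φ x) := fun x => by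
    linear_combination Real.cos (φ x) * hC x + Real.sin (φ x) * hS x
      - (e₀ * T₀ x + e₁ * T₁ x) * Real.sin_sq_add_cos_sq (φ x)
  have hsin : ∀ x, e₀ * T₁ x - e₁ * T₀ x = ε * Real.sin (φ x) := fun x => by
    linear_combination ε * (Real.sin (φ x) * hC x - Real.cos (φ x) * hS x)
      - ε ^ 2 * (e₀ * T₁ x - e₁ * T₀ x) * Real.sin_sq_add_cos_sq (φ x)
      - (e₀ * T₁ x - e₁ * T₀ x) * hε
  have hadv := advance_of_periodic_deriv hφ fun x => by simp only [h.periodic_speed x]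
  have hPpos : 0 < φ 1 - φ 0 := sub_pos.2 (strictMono_of_hasDerivAt_pos hφ hw one_pos)
  -- The tangent returns after one turn of `ℝ/ℤ`, so `cos (φ 1) = 1`; the covering number is the
  -- total turning in units of `2π`.
  obtain ⟨n, hn⟩ : ∃ n : ℤ, (n : ℝ) * (2 * Real.pi) = φ 1 := by
    refine (Real.cos_eq_one_iff _).1 ?_
    have h0 := h.periodic_tangent_fst 0
    have h1 := h.periodic_tangent_snd 0
    rw [zero_add, ← he₀] at h0
    rw [zero_add, ← he₁] at h1
    rw [← hcos, h0, h1]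
    linear_combination he
  have hnpos : 0 < n := by
    rw [hφ0, sub_zero, ← hn] at hPpos
    exact_mod_cast (pos_iff_pos_of_mul_pos hPpos).2 (by positivity)
  have hμ : ((n.toNat : ℕ) : ℝ) = n := by exact_mod_cast Int.toNat_of_nonneg hnpos.le
  have hX' : ∀ x : ℝ, ρ * (e₀ * γ x 0 + e₁ * γ x 1)
      = ρ * (e₀ * γ (0 : ℝ) 0 + e₁ * γ (0 : ℝ) 1) + Real.sin (φ x) := by
    intro x
    have hd : ∀ x, HasDerivAt
        (fun x : ℝ => ρ * (e₀ * γ x 0 + e₁ * γ x 1) - Real.sin (φ x)) 0 x := fun x =>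
      (((hX x).const_mul ρ).fun_sub (hφ x).sin).congr_deriv (by rw [hcos]; ring)
    have := eq_of_hasDerivAt_zero hd x 0
    rw [hφ0, Real.sin_zero] at this
    linarith
  have hY' : ∀ x : ℝ, ρ * (e₀ * γ x 1 - e₁ * γ x 0)
      = ρ * (e₀ * γ (0 : ℝ) 1 - e₁ * γ (0 : ℝ) 0) + ε + ε * -Real.cos (φ x) := by
    intro x
    have hd : ∀ x, HasDerivAt
        (fun x : ℝ => ρ * (e₀ * γ x 1 - e₁ * γ x 0) + ε * Real.cos (φ x)) 0 x := fun x =>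
      (((hY x).const_mul ρ).fun_add ((hφ x).cos.const_mul ε)).congr_deriv (by rw [hsin]; ring)
    have := eq_of_hasDerivAt_zero hd x 0
    rw [hφ0, Real.cos_zero] at this
    linarith
  exact ⟨n.toNat, by omega, isCoverOf_of_coords he hε hρ hw hws hφ
    (fun x => by rw [hadv, hφ0, sub_zero, hμ, hn]) hX' hY'⟩

end IsElasticFrame

end Elastica

theorem theorem2p16 :
    ∃ mstar : ℝ, Elastica.IsFigureEightParameter mstar ∧
      (∀ m : ℝ, Elastica.IsFigureEightParameter m → m = mstar) ∧
      ∀ γ : UnitAddCircle → EuclideanSpace ℝ (Fin 2), Elastica.IsClosedElastica γ →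
        ∃ μ : ℕ, 1 ≤ μ ∧ (Elastica.IsCircle μ γ ∨ Elastica.IsFigureEight μ mstar γ) := by
  obtain ⟨mstar, hm⟩ := Elastica.exists_figureEightParameter
  refine ⟨mstar, hm, fun m h => Elastica.figureEightParameter_unique h hm, ?_⟩
  rintro γ ⟨lam, hγ⟩
  obtain ⟨V₀, V₁, v, T₀, T₁, k, k', hf⟩ := hγ.exists_isElasticFrame fun x => by
    simp only [AddCircle.coe_add_period]
  by_cases hV : V₀ ^ 2 + V₁ ^ 2 = 0
  · obtain ⟨μ, hμ, hc⟩ := hf.exists_isCircle hV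
    exact ⟨μ, hμ, Or.inl hc⟩
  · obtain ⟨m, μ, hμ, h8⟩ := hf.exists_isFigureEight hV
    exact ⟨μ, hμ, Or.inr (Elastica.figureEightParameter_unique h8.1 hm ▸ h8)⟩
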